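/- Let $p$ be an odd prime. A group $P$ is called capable if $P\cong M/Z(M)$ for some group $M$. Let $G$ and $K$ be nonabelian groups, nilpotent of class two and of exponent $p$. Let $H$ be a nontrivial subgroup of $[G,G]$, and let $\phi\colon H\to[K,K]$ be an injective homomorphism. Let $F=G*K$ be the free product, let $G\amalg^{\mathfrak N_2}K=F/[[F,F],F]$ be the $2$-nilpotent product of $G$ and $K$, and let $$G\amalg_\phi^{\mathfrak N_2}K=\frac{G\amalg^{\mathfrak N_2}K}{\{\,h\,\phi(h)^{-1} : h\in H\,\}}$$ be the amalgamated coproduct of $G$ and $K$ along $\phi$, where $h$ and $\phi(h)$ are identified with their images in $G\amalg^{\mathfrak N_2}K$ (the set in the denominator is a central subgroup). If $G$ is capable or $K$ is capable, then $G\amalg_\phi^{\mathfrak N_2}K$ is capable. -/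

import Mathlib

universe u v

/-- A group `G` is capable if it is isomorphic to `H ⧸ Z(H)` for some group `H`. (Replacing `H` by
the subgroup generated by lifts of the elements of `G` shows that the universe of `H` is no
restriction.) -/
def Capable (G : Type u) [Group G] : Prop :=
  ∃ (H : Type u) (_ : Group H), Nonempty (G ≃* H ⧸ Subgroup.center H)

/-- `G` is nilpotent of class at most two: the third term `[[G, G], G]` of its lower central
series is trivial. (Mathlib numbers the lower central series from zero.) -/
def ClassAtMostTwo (G : Type u) [Group G] : Prop :=
  (⊤ : Subgroup G).lowerCentralSeries 2 = ⊥

/-- The `2`-nilpotent product of `A` and `B`: the quotient of the free product `F = A * B` by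
the third term `[[F, F], F]` of its lower central series. -/
abbrev TwoNilpotentProduct (A : Type u) (B : Type v) [Group A] [Group B] : Type (max u v) :=
  Monoid.Coprod A B ⧸ (⊤ : Subgroup (Monoid.Coprod A B)).lowerCentralSeries 2

namespace TwoNilpotentProduct

/-- The canonical map from the first factor. -/
def inl (A : Type u) (B : Type v) [Group A] [Group B] : A →* TwoNilpotentProduct A B :=
  (QuotientGroup.mk' _).comp Monoid.Coprod.inl

/-- The canonical map from the second factor. -/
def inr (A : Type u) (B : Type v) [Group A] [Group B] : B →* TwoNilpotentProduct A B :=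
  (QuotientGroup.mk' _).comp Monoid.Coprod.inr

theorem commutator_le_center (A : Type u) (B : Type v) [Group A] [Group B] :
    commutator (TwoNilpotentProduct A B) ≤ Subgroup.center (TwoNilpotentProduct A B) := by
  rw [← Subgroup.commutator_top_right_eq_bot_iff_le_center]
  change (⊤ : Subgroup (TwoNilpotentProduct A B)).lowerCentralSeries 2 = ⊥
  have hs : Function.Surjective (QuotientGroup.mk'
      ((⊤ : Subgroup (Monoid.Coprod A B)).lowerCentralSeries 2)) :=
    QuotientGroup.mk'_surjective _
  rw [← Subgroup.map_top_of_surjective _ hs, ← Subgroup.map_lowerCentralSeries]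
  exact (Subgroup.map_eq_bot_iff _).2 (by rw [QuotientGroup.ker_mk'])

end TwoNilpotentProduct

/-- The set of all `h φ(h)⁻¹`, `h ∈ H`, in the `2`-nilpotent product of `G` and `K`. -/
def amalgamSet {G : Type u} {K : Type v} [Group G] [Group K] (H : Subgroup G)
    (φ : H →* commutator K) : Set (TwoNilpotentProduct G K) :=
  {x | ∃ h : H, x = TwoNilpotentProduct.inl G K (h : G) *
    (TwoNilpotentProduct.inr G K (φ h : K))⁻¹}

/-- The amalgamated coproduct of `G` and `K` along `φ : H → [K, K]`: the quotient of the
`2`-nilpotent product by the (normal subgroup generated by the) elements `h φ(h)⁻¹`. When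
`H ≤ [G, G]` these elements already form a normal subgroup, see `coe_normalClosure_amalgamSet`. -/
abbrev AmalgamatedCoproduct {G : Type u} {K : Type v} [Group G] [Group K] (H : Subgroup G)
    (φ : H →* commutator K) : Type (max u v) :=
  TwoNilpotentProduct G K ⧸ Subgroup.normalClosure (amalgamSet H φ)

theorem coe_normalClosure_amalgamSet {G : Type u} {K : Type v} [Group G] [Group K]
    (H : Subgroup G) (hH : H ≤ commutator G) (φ : H →* commutator K) :
    (Subgroup.normalClosure (amalgamSet H φ) : Set (TwoNilpotentProduct G K)) =
      amalgamSet H φ := by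
  have hl : ∀ h : H, TwoNilpotentProduct.inl G K (h : G) ∈
      Subgroup.center (TwoNilpotentProduct G K) := fun h =>
    TwoNilpotentProduct.commutator_le_center G K
      ((Subgroup.map_commutator _ _ _).le.trans (Subgroup.commutator_mono le_top le_top)
        (Subgroup.mem_map_of_mem (TwoNilpotentProduct.inl G K) (hH h.2)))
  have hr : ∀ h : H, (TwoNilpotentProduct.inr G K (φ h : K))⁻¹ ∈
      Subgroup.center (TwoNilpotentProduct G K) := fun h =>
    inv_mem (TwoNilpotentProduct.commutator_le_center G K
      ((Subgroup.map_commutator _ _ _).le.trans (Subgroup.commutator_mono le_top le_top)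
        (Subgroup.mem_map_of_mem (TwoNilpotentProduct.inr G K) (φ h).2)))
  let N : Subgroup (TwoNilpotentProduct G K) :=
    { carrier := amalgamSet H φ
      one_mem' := ⟨1, by simp⟩
      mul_mem' := by
        rintro _ _ ⟨a, rfl⟩ ⟨b, rfl⟩
        refine ⟨a * b, ?_⟩
        have h1 := Subgroup.mem_center_iff.1 (hr a)
        have h2 := Subgroup.mem_center_iff.1 (hr b)
        simp only [Subgroup.coe_mul, map_mul, mul_inv_rev]
        rw [mul_assoc, ← mul_assoc _ _ (_)⁻¹, ← h1, mul_assoc, mul_assoc, h2]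
      inv_mem' := by
        rintro _ ⟨a, rfl⟩
        refine ⟨a⁻¹, ?_⟩
        have h1 := Subgroup.mem_center_iff.1 (inv_mem (hl a))
        simp only [mul_inv_rev, inv_inv, InvMemClass.coe_inv, map_inv]
        exact h1 _ }
  have hN : N.Normal := ⟨by
    rintro _ ⟨h, rfl⟩ g
    rw [Subgroup.mem_center_iff.1 (mul_mem (hl h) (hr h)) g, mul_inv_cancel_right]
    exact ⟨h, rfl⟩⟩
  exact subset_antisymm (Subgroup.normalClosure_le_normal (N := N) subset_rfl)
    Subgroup.subset_normalClosure

/-! By symmetry let `G ≅ L/Z(L)` via `π : L → G`. The coproduct `P` enters only through its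
universal property (`IsAmalgam`). It suffices to find surjections of `P` onto central quotients
`E/Z(E)` with trivial common kernel (`Capable.of_jointly_injective`).

Each `E` is a semidirect product `(L × S) ⋊ K` with `S = G^ab ⊗ K^ab` over `𝔽_p`, where `k` sends
`(l, s)` to `(l · T_k(π l) · β(s, k), s · σ(π l, k))` and `T_k : G → Z(L)` is a homomorphism. This
is an action exactly because `T` is quadratic in `k` with polarization `β` (`QuadraticTwist`).
Commutators in `L` give an injection `θ : Z(G) → Hom(G, Z(L))`. If `T (b h) = θ (a h)` for all `h`,
then `a h` and `b h` agree modulo `Z(E)`, so `P` maps onto `E/Z(E)`. An element `g k s` of the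
kernel has `g ∈ [G, G]`, `k ∈ [K, K]`, `β(s, ·) = 1` and `T_k θ_g = 1`
(`IsAmalgam.exists_hom_product`).

There are enough twists. By the Baer correspondence `K` is an `𝔽_p`-space with `b(H)` as a subspace,
and every additive map from it to `Hom(G, Z(L))` is a twist (`QuadraticTwist.exists_of_baer`).
Extending `b h ↦ θ (a h)` gives one compatible twist `T₀`. Since `H` is nontrivial, `Hom(G, Z(L))`
is nonzero, and multiplying `T₀` by further twists forces `s = 1` (a quadratic form, `p` being odd)
and `k = b h` for some `h`. Then `θ (a h · g) = 1`, so `a h · g = 1` and the kernel element is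
trivial. -/

open scoped commutatorElement IsMulCommutative TensorProduct

/-! ### Commutators with central values -/

theorem mul_eq_commutatorElement_mul {Q : Type*} [Group Q] (x y : Q) :
    x * y = ⁅x, y⁆ * (y * x) := by
  simp [commutatorElement_def, mul_assoc]

theorem commutatorElement_mul_left_of_mem_center {Q : Type*} [Group Q] {x₁ x₂ y : Q}
    (h : ⁅x₂, y⁆ ∈ Subgroup.center Q) : ⁅x₁ * x₂, y⁆ = ⁅x₁, y⁆ * ⁅x₂, y⁆ := by
  have h1 : ⁅x₁ * x₂, y⁆ = x₁ * ⁅x₂, y⁆ * x₁⁻¹ * ⁅x₁, y⁆ := by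
    simp [commutatorElement_def, mul_assoc]
  rw [h1, Subgroup.mem_center_iff.1 h x₁, mul_inv_cancel_right, Subgroup.mem_center_iff.1 h]

theorem commutatorElement_mul_right_of_mem_center {Q : Type*} [Group Q] {x y₁ y₂ : Q}
    (h : ⁅x, y₂⁆ ∈ Subgroup.center Q) : ⁅x, y₁ * y₂⁆ = ⁅x, y₁⁆ * ⁅x, y₂⁆ := by
  have h1 : ⁅x, y₁ * y₂⁆ = ⁅x, y₁⁆ * (y₁ * ⁅x, y₂⁆ * y₁⁻¹) := by
    simp [commutatorElement_def, mul_assoc]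
  rw [h1, Subgroup.mem_center_iff.1 h y₁, mul_inv_cancel_right]

/-- The pairing `(a, b) ↦ ⁅f a, g b⁆` when all these commutators are central. -/
def commutatorPairing {A B Q : Type*} [Group A] [Group B] [Group Q] (f : A →* Q) (g : B →* Q)
    (h : ∀ a b, ⁅f a, g b⁆ ∈ Subgroup.center Q) : A →* B →* Subgroup.center Q where
  toFun a :=
    { toFun := fun b => ⟨⁅f a, g b⁆, h a b⟩
      map_one' := Subtype.ext (by simp)
      map_mul' := fun b₁ b₂ => Subtype.ext (by
        simpa using commutatorElement_mul_right_of_mem_center (h a b₂)) }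
  map_one' := by ext; simp
  map_mul' a₁ a₂ := by
    ext b
    simpa using commutatorElement_mul_left_of_mem_center (h a₂ b)

/-! ### Capability from a family of central quotients -/

/-- A group with a jointly injective family of surjections onto central quotients is capable. -/
theorem Capable.of_jointly_injective {P : Type u} [Group P] {ι : Type u} (E : ι → Type u)
    [∀ i, Group (E i)] (f : ∀ i, P →* E i ⧸ Subgroup.center (E i))
    (hf : ∀ i, Function.Surjective (f i)) (hinj : ∀ z, (∀ i, f i z = 1) → z = 1) :
    Capable P := by
  -- `D` is the fibre product of `P` with all the `E i`; the kernel of its projection to `P` is the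
  -- product of the centres of the `E i`, and turns out to be the centre of `D`.
  let D : Subgroup (P × ∀ i, E i) :=
    { carrier := {x | ∀ i, f i x.1 = (x.2 i : E i ⧸ Subgroup.center (E i))}
      one_mem' := fun i => by simp
      mul_mem' := fun {x y} hx hy i => by simp [hx i, hy i]
      inv_mem' := fun {x} hx i => by simp [hx i] }
  have lift : ∀ z : P, ∃ e : ∀ i, E i, ∀ i, f i z = (e i : E i ⧸ Subgroup.center (E i)) := by
    intro z
    choose e he using fun i => QuotientGroup.mk_surjective (f i z)
    exact ⟨e, fun i => (he i).symm⟩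
  let q : D →* P := (MonoidHom.fst _ _).comp D.subtype
  have hq : Function.Surjective q := fun z => by
    obtain ⟨e, he⟩ := lift z
    exact ⟨⟨(z, e), he⟩, rfl⟩
  have hker : q.ker = Subgroup.center D := by
    ext ⟨⟨z, e⟩, hze⟩
    rw [MonoidHom.mem_ker, Subgroup.mem_center_iff]
    constructor
    · rintro (rfl : z = 1)
      rintro ⟨⟨z', e'⟩, -⟩
      refine Subtype.ext (Prod.ext (by simp) (funext fun i => ?_))
      have h1 : e i ∈ Subgroup.center (E i) := by
        rw [← QuotientGroup.eq_one_iff, ← hze i, map_one]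
      exact Subgroup.mem_center_iff.1 h1 _
    · intro h
      refine hinj z fun i => ?_
      rw [hze i, QuotientGroup.eq_one_iff, Subgroup.mem_center_iff]
      intro g
      classical
      obtain ⟨z', hz'⟩ := hf i g
      obtain ⟨e', he'⟩ := lift z'
      -- To test `e i` against an arbitrary `g`, some element of `D` must have `i`-th coordinate
      -- `g`; surjectivity of `f i` supplies its image `z'` in `P`.
      have hmem : (z', Function.update e' i g) ∈ D := fun j => by
        by_cases hj : j = i
        · subst hj
          simpa using hz'
        · simpa [hj] using he' j
      have := congrArg (fun x : D => x.1.2 i) (h ⟨_, hmem⟩)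
      simpa using this
  exact ⟨D, inferInstance, ⟨((QuotientGroup.quotientMulEquivOfEq hker.symm).trans
    (QuotientGroup.quotientKerEquivOfSurjective q hq)).symm⟩⟩

/-! ### The Baer correspondence -/

/-- The Baer correspondence: a group of class two and odd exponent `p = 2 d + 1` carries the
structure of an `𝔽_p`-vector space, with `x + y = x y ⁅x, y⁆ ^ d`. -/
theorem exists_baer_vectorSpace {p d : ℕ} [Fact p.Prime] (hd : p = 2 * d + 1) {K : Type v}
    [Group K] (hK : commutator K ≤ Subgroup.center K) (hp : ∀ x : K, x ^ p = 1) :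
    ∃ (B : Type v) (_ : AddCommGroup B) (_ : Module (ZMod p) B) (e : K ≃ B), ∀ x y,
      e (x * y * ⁅x, y⁆ ^ d) = e x + e y := by
  have hc : ∀ x y : K, ⁅x, y⁆ ∈ Subgroup.center K := fun x y =>
    hK (Subgroup.commutator_mem_commutator trivial trivial)
  have hcd : ∀ x y : K, ⁅x, y⁆ ^ d ∈ Subgroup.center K := fun x y => pow_mem (hc x y) d
  have hl : ∀ x₁ x₂ y : K, ⁅x₁ * x₂, y⁆ = ⁅x₁, y⁆ * ⁅x₂, y⁆ := fun x₁ x₂ y =>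
    commutatorElement_mul_left_of_mem_center (hc x₂ y)
  have hr : ∀ x y₁ y₂ : K, ⁅x, y₁ * y₂⁆ = ⁅x, y₁⁆ * ⁅x, y₂⁆ := fun x y₁ y₂ =>
    commutatorElement_mul_right_of_mem_center (hc x y₂)
  have hzl : ∀ z ∈ Subgroup.center K, ∀ y : K, ⁅z, y⁆ = 1 := fun z hz y =>
    commutatorElement_eq_one_iff_mul_comm.2 (Subgroup.mem_center_iff.1 hz y).symm
  have hzr : ∀ z ∈ Subgroup.center K, ∀ y : K, ⁅y, z⁆ = 1 := fun z hz y =>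
    commutatorElement_eq_one_iff_mul_comm.2 (Subgroup.mem_center_iff.1 hz y)
  have hmul : ∀ x y z : K, (⁅x, y⁆ * z) ^ d = ⁅x, y⁆ ^ d * z ^ d := fun x y z =>
    Commute.mul_pow (Subgroup.mem_center_iff.1 (hc x y) z).symm d
  let add : K → K → K := fun x y => x * y * ⁅x, y⁆ ^ d
  have hassoc : ∀ x y z, add (add x y) z = add x (add y z) := by
    intro x y z
    simp only [add, hl, hr, hzl _ (hcd x y), hzr _ (hcd y z), mul_one, hmul]
    have h1 := Subgroup.mem_center_iff.1 (hcd x y) z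
    have h2 := Subgroup.mem_center_iff.1 (hcd y z)
    calc x * y * ⁅x, y⁆ ^ d * z * (⁅x, z⁆ ^ d * ⁅y, z⁆ ^ d)
        = x * y * (⁅x, y⁆ ^ d * z) * (⁅x, z⁆ ^ d * ⁅y, z⁆ ^ d) := by group
      _ = x * y * z * (⁅x, y⁆ ^ d * ⁅x, z⁆ ^ d * ⁅y, z⁆ ^ d) := by rw [← h1]; group
      _ = x * y * z * (⁅y, z⁆ ^ d * (⁅x, y⁆ ^ d * ⁅x, z⁆ ^ d)) := by rw [← h2]
      _ = x * (y * z * ⁅y, z⁆ ^ d) * (⁅x, y⁆ ^ d * ⁅x, z⁆ ^ d) := by group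
  have hcomm : ∀ x y, add x y = add y x := by
    intro x y
    simp only [add]
    rw [mul_eq_commutatorElement_mul x y,
      ← Subgroup.mem_center_iff.1 (hc x y) (y * x), mul_assoc, ← pow_succ',
      ← commutatorElement_inv x y]
    congr 1
    -- The exponent `d` is minus one half modulo `p`: `⁅x, y⁆ ^ (d + 1)` is inverse to `⁅x, y⁆ ^ d`,
    -- which makes the sum symmetric.
    rw [inv_pow, eq_inv_iff_mul_eq_one, ← pow_add, show d + 1 + d = p by omega, hp]
  have hone : ∀ x, add 1 x = x := fun x => by simp [add]
  have hinv : ∀ x, add x⁻¹ x = 1 := fun x => by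
    have : ⁅x⁻¹, x⁆ = 1 := commutatorElement_eq_one_iff_mul_comm.2 (by simp)
    simp [add, this]
  let _ : Add K := ⟨add⟩
  let _ : Zero K := ⟨1⟩
  let _ : Neg K := ⟨fun x => x⁻¹⟩
  let _ : AddCommGroup K :=
    { AddGroup.ofLeftAxioms hassoc hone hinv with
      add_comm := hcomm }
  have hadd : ∀ x y : K, x + y = x * y * ⁅x, y⁆ ^ d := fun x y => rfl
  have hnsmul : ∀ (n : ℕ) (x : K), n • x = x ^ n := by
    intro n x
    induction n with
    | zero => rw [zero_smul, pow_zero]; rfl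
    | succ n ih =>
      have : ⁅x ^ n, x⁆ = 1 := commutatorElement_eq_one_iff_mul_comm.2 (by rw [← pow_succ, pow_succ'])
      rw [succ_nsmul, ih, hadd, this, one_pow, mul_one, pow_succ]
  have hpn : ∀ x : K, p • x = 0 := fun x => (hnsmul p x).trans (hp x)
  exact ⟨K, inferInstance, AddCommGroup.zmodModule hpn, Equiv.refl K, fun x y => (hadd x y).symm⟩

/-! ### Quadratic twists and their semidirect products -/

/-- A map from `K` to `Hom(G, C)` that is quadratic, with polarization factoring through the
pairing `σ : G → K → S`. -/
structure QuadraticTwist {G K S : Type*} [Group G] [Group K] [CommGroup S] (σ : G →* K →* S)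
    (C : Type*) [CommGroup C] where
  /-- The quadratic map. -/
  toFun : K → G →* C
  /-- Its polarization. -/
  polar : S →* K →* C
  map_mul' : ∀ x y g, toFun (x * y) g = toFun x g * toFun y g * polar (σ g y) x

namespace QuadraticTwist

variable {G K S L : Type*} [Group G] [Group K] [CommGroup S] [Group L] {σ : G →* K →* S}

theorem map_one {C : Type*} [CommGroup C] (T : QuadraticTwist σ C) : T.toFun 1 = 1 := by
  ext g
  have := T.map_mul' 1 1 g
  simpa using this

/-- The pointwise product of two quadratic twists. -/
def mul {C : Type*} [CommGroup C] (T T' : QuadraticTwist σ C) : QuadraticTwist σ C where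
  toFun x := T.toFun x * T'.toFun x
  polar := T.polar * T'.polar
  map_mul' x y g := by
    simp only [MonoidHom.mul_apply, T.map_mul', T'.map_mul']
    simp only [mul_assoc, mul_left_comm]

variable (T : QuadraticTwist σ (Subgroup.center L)) (π : L →* G)
  (hπ : ∀ z ∈ Subgroup.center L, π z = 1)

/-- The action of `K` on `L × S` defined by a quadratic twist. -/
def action : K →* MulAut (L × S) :=
  letI : MulDistribMulAction K (L × S) :=
    { smul := fun k n => (n.1 * (T.toFun k (π n.1) * T.polar n.2 k : Subgroup.center L),
        n.2 * σ (π n.1) k)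
      one_smul := fun n => by
        change (n.1 * (T.toFun 1 (π n.1) * T.polar n.2 1 : Subgroup.center L),
          n.2 * σ (π n.1) 1) = n
        simp [T.map_one]
      mul_smul := fun x y n => by
        change (n.1 * (T.toFun (x * y) (π n.1) * T.polar n.2 (x * y) : Subgroup.center L),
          n.2 * σ (π n.1) (x * y)) =
          (n.1 * (T.toFun y (π n.1) * T.polar n.2 y : Subgroup.center L) *
            (T.toFun x (π (n.1 * (T.toFun y (π n.1) * T.polar n.2 y : Subgroup.center L))) *
              T.polar (n.2 * σ (π n.1) y) x : Subgroup.center L),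
            n.2 * σ (π n.1) y *
              σ (π (n.1 * (T.toFun y (π n.1) * T.polar n.2 y : Subgroup.center L))) x)
        -- The central factor is invisible to `π`, so acting by `y` and then `x` adds only the term
        -- `polar (σ (π l) y) x`, which is the polarization in `T.map_mul'`.
        rw [_root_.map_mul π, hπ _ (SetLike.coe_mem _), mul_one, mul_assoc, ← Subgroup.coe_mul,
          T.map_mul']
        simp only [_root_.map_mul, MonoidHom.mul_apply]
        refine Prod.ext (congrArg (fun c : Subgroup.center L => n.1 * (c : L)) ?_) ?_
        · simp only [mul_assoc, mul_left_comm, mul_comm]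
        · simp only [mul_left_comm, mul_comm]
      smul_mul := fun k m n => by
        change (m.1 * n.1 * (T.toFun k (π (m.1 * n.1)) * T.polar (m.2 * n.2) k :
            Subgroup.center L), m.2 * n.2 * σ (π (m.1 * n.1)) k) =
          (m.1 * (T.toFun k (π m.1) * T.polar m.2 k : Subgroup.center L) *
            (n.1 * (T.toFun k (π n.1) * T.polar n.2 k : Subgroup.center L)),
            m.2 * σ (π m.1) k * (n.2 * σ (π n.1) k))
        have h := Subgroup.mem_center_iff.1
          (T.toFun k (π m.1) * T.polar m.2 k : Subgroup.center L).2 n.1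
        refine Prod.ext ?_ ?_
        · change m.1 * n.1 * _ =
            m.1 * ((T.toFun k (π m.1) * T.polar m.2 k : Subgroup.center L) : L) *
              (n.1 * ((T.toFun k (π n.1) * T.polar n.2 k : Subgroup.center L) : L))
          rw [mul_assoc m.1 _ (n.1 * _), ← mul_assoc _ n.1, ← h, mul_assoc n.1,
            ← Subgroup.coe_mul, ← mul_assoc]
          refine congrArg (fun c : Subgroup.center L => m.1 * n.1 * (c : L)) ?_
          simp only [_root_.map_mul, MonoidHom.mul_apply, mul_assoc, mul_left_comm]
        · simp only [_root_.map_mul, MonoidHom.mul_apply, mul_assoc, mul_left_comm]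
      smul_one := fun k => by
        change ((1 : L) * (T.toFun k (π 1) * T.polar 1 k : Subgroup.center L), (1 : S) * σ (π 1) k) =
          (1, 1)
        simp }
  MulDistribMulAction.toMulAut K (L × S)

theorem action_apply (k : K) (n : L × S) : T.action π hπ k n =
    (n.1 * (T.toFun k (π n.1) * T.polar n.2 k : Subgroup.center L), n.2 * σ (π n.1) k) := rfl

/-- The semidirect product defined by a quadratic twist. -/
abbrev Product : Type _ := (L × S) ⋊[T.action π hπ] K

variable {T π hπ}

/-- The products with `⟨(l, s), k⟩` in both orders are compared component by component; in the
abelian group `S` the common factors cancel, leaving only values of `σ`. -/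
theorem mem_center_iff {e : T.Product π hπ} : e ∈ Subgroup.center (T.Product π hπ) ↔
    ∀ l s k, l * e.left.1 * (T.toFun k (π e.left.1) * T.polar e.left.2 k : Subgroup.center L) =
      e.left.1 * l * (T.toFun e.right (π l) * T.polar s e.right : Subgroup.center L) ∧
      σ (π e.left.1) k = σ (π l) e.right ∧ k * e.right = e.right * k := by
  rw [Subgroup.mem_center_iff]
  constructor
  · intro h l s k
    have h1 := h ⟨(l, s), k⟩
    rw [SemidirectProduct.ext_iff] at h1
    simp only [SemidirectProduct.mul_left, SemidirectProduct.mul_right, action_apply,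
      Prod.mk_mul_mk, Prod.ext_iff, Prod.fst_mul, Prod.snd_mul] at h1
    obtain ⟨⟨h1, h2⟩, h3⟩ := h1
    refine ⟨by simpa only [mul_assoc] using h1, ?_, h3⟩
    rw [← mul_assoc, ← mul_assoc, mul_comm s] at h2
    exact mul_left_cancel h2
  · rintro h ⟨⟨l, s⟩, k⟩
    obtain ⟨h1, h2, h3⟩ := h l s k
    refine SemidirectProduct.ext (Prod.ext ?_ ?_) h3
    · simpa only [SemidirectProduct.mul_left, action_apply, Prod.fst_mul, mul_assoc] using h1
    · simp only [SemidirectProduct.mul_left, action_apply, Prod.snd_mul, h2]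
      rw [← mul_assoc, ← mul_assoc, mul_comm s]

theorem inl_mem_center {z : L} (hz : z ∈ Subgroup.center L) :
    (SemidirectProduct.inl (z, 1) : T.Product π hπ) ∈ Subgroup.center (T.Product π hπ) := by
  rw [mem_center_iff]
  intro l s k
  simp [hπ z hz, T.map_one, Subgroup.mem_center_iff.1 hz l]

/-- An element over the commutator subgroups of `G` and `K` commutes with everything up to the
centre of `L`. -/
theorem commutator_le_center_quotient (hG : commutator G ≤ Subgroup.center G)
    (hK : commutator K ≤ Subgroup.center K) (hker : ∀ l, π l = 1 → l ∈ Subgroup.center L) :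
    commutator (T.Product π hπ ⧸ Subgroup.center (T.Product π hπ)) ≤
      Subgroup.center (T.Product π hπ ⧸ Subgroup.center (T.Product π hπ)) := by
  have hab : ∀ e ∈ commutator (T.Product π hπ), π e.left.1 ∈ commutator G ∧
      e.right ∈ commutator K := by
    let f : T.Product π hπ →* Abelianization G × Abelianization K :=
      { toFun := fun e => (Abelianization.of (π e.left.1), Abelianization.of e.right)
        map_one' := by simp
        map_mul' := fun e e' => by
          simp only [SemidirectProduct.mul_left, SemidirectProduct.mul_right, action_apply,
            Prod.fst_mul, _root_.map_mul, Prod.mk_mul_mk]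
          rw [hπ _ (SetLike.coe_mem _), _root_.map_one, mul_one] }
    intro e he
    have h1 : f e = 1 := Abelianization.commutator_subset_ker f he
    rw [← Abelianization.ker_of G, ← Abelianization.ker_of K]
    exact ⟨congrArg Prod.fst h1, congrArg Prod.snd h1⟩
  rw [← Subgroup.commutator_top_right_eq_bot_iff_le_center]
  have hs := QuotientGroup.mk'_surjective (Subgroup.center (T.Product π hπ))
  rw [commutator_def, ← Subgroup.map_top_of_surjective _ hs, ← Subgroup.map_commutator,
    ← Subgroup.map_commutator, Subgroup.map_eq_bot_iff, QuotientGroup.ker_mk',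
    Subgroup.commutator_le]
  intro e he e' _
  obtain ⟨hg, hk⟩ := hab e he
  have hright : e.right * e'.right = e'.right * e.right :=
    (Subgroup.mem_center_iff.1 (hK hk) _).symm
  have hσl : ∀ k, σ (π e.left.1) k = 1 := fun k =>
    DFunLike.congr_fun (Abelianization.commutator_subset_ker σ hg : σ (π e.left.1) = 1) k
  have hσr : ∀ g, σ g e.right = 1 := fun g => Abelianization.commutator_subset_ker (σ g) hk
  have hcomm : ∃ z ∈ Subgroup.center L, e * e' = SemidirectProduct.inl (z, 1) * (e' * e) := by
    have hπc : π (e.left.1 * e'.left.1) = π (e'.left.1 * e.left.1) := by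
      rw [_root_.map_mul, _root_.map_mul, Subgroup.mem_center_iff.1 (hG hg)]
    -- The `S`- and `K`-components of the two products agree, as `σ` kills commutators and `e.right`
    -- is central in `K`; the discrepancy lies in `L`, over `1` in `G`.
    refine ⟨(e * e').left.1 * ((e' * e).left.1)⁻¹, hker _ ?_, ?_⟩
    · simp only [SemidirectProduct.mul_left, action_apply, Prod.fst_mul, _root_.map_mul, map_inv]
      rw [hπ _ (SetLike.coe_mem _), hπ _ (SetLike.coe_mem _), mul_one, mul_one,
        ← _root_.map_mul, ← _root_.map_mul, hπc, mul_inv_cancel]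
    · refine SemidirectProduct.ext (Prod.ext ?_ ?_) ?_
      · simp only [SemidirectProduct.mul_left, SemidirectProduct.left_inl,
          SemidirectProduct.right_inl, _root_.map_one, MulAut.one_apply, Prod.fst_mul,
          inv_mul_cancel_right]
      · simp only [SemidirectProduct.mul_left, SemidirectProduct.left_inl,
          SemidirectProduct.right_inl, _root_.map_one, MulAut.one_apply, Prod.snd_mul,
          action_apply, hσl, hσr, mul_one, one_mul]
        exact mul_comm _ _
      · simpa using hright
  obtain ⟨z, hz, h⟩ := hcomm
  rw [mul_eq_commutatorElement_mul] at h
  rw [mul_right_cancel h]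
  exact inl_mem_center hz

end QuadraticTwist

/-! ### The commutator pairing of a central extension -/

theorem commutatorElement_mul_left_of_left_mem_center {Q : Type*} [Group Q] {z : Q}
    (hz : z ∈ Subgroup.center Q) (x y : Q) : ⁅z * x, y⁆ = ⁅x, y⁆ := by
  have h := Subgroup.mem_center_iff.1 hz
  rw [commutatorElement_def, commutatorElement_def, mul_inv_rev, mul_assoc z, ← h (x * y),
    mul_assoc (x * y), ← h]
  group

/-- If `L → G` is a central extension whose kernel is the centre of `L`, then commutators in `L`
define a pairing of the centre of `G` with `G`. -/
theorem exists_centerPairing {G L : Type*} [Group G] [Group L] (π : L →* G)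
    (hs : Function.Surjective π) (hker : ∀ l, π l = 1 ↔ l ∈ Subgroup.center L) :
    ∃ θ : Subgroup.center G →* G →* Subgroup.center L,
      (∀ (z : Subgroup.center G) (l l' : L), π l = z → (θ z (π l') : L) = ⁅l, l'⁆) := by
  have key : ∀ l₁ l₂ l' : L, π l₁ = π l₂ → ⁅l₁, l'⁆ = ⁅l₂, l'⁆ := by
    intro l₁ l₂ l' h
    have hz : l₁ * l₂⁻¹ ∈ Subgroup.center L := (hker _).1 (by simp [h])
    have := commutatorElement_mul_left_of_left_mem_center hz l₂ l'
    rwa [inv_mul_cancel_right] at this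
  have key' : ∀ l l₁ l₂ : L, π l₁ = π l₂ → ⁅l, l₁⁆ = ⁅l, l₂⁆ := by
    intro l l₁ l₂ h
    rw [← commutatorElement_inv, key _ _ _ h, commutatorElement_inv]
  -- Commutators of `A` with `L` die in `G`, hence are central, which makes the pairing
  -- bimultiplicative; `key` and `key'` remove the dependence on the section `s`.
  let A : Subgroup L := (Subgroup.center G).comap π
  have hA : ∀ (l : A) (l' : L), ⁅A.subtype l, MonoidHom.id L l'⁆ ∈ Subgroup.center L :=
    fun l l' => (hker _).1 (by
      rw [map_commutatorElement, commutatorElement_eq_one_iff_mul_comm]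
      exact (Subgroup.mem_center_iff.1 l.2 _).symm)
  let c := commutatorPairing A.subtype (MonoidHom.id L) hA
  obtain ⟨s, hs⟩ := hs.hasRightInverse
  let s' : Subgroup.center G → A := fun z => ⟨s z, by
    simp only [A, Subgroup.mem_comap, hs (z : G), SetLike.coe_mem]⟩
  let θ : Subgroup.center G →* G →* Subgroup.center L := MonoidHom.mk'
    (fun z => MonoidHom.mk' (fun g => c (s' z) (s g)) fun g g' => by
      rw [← map_mul]
      exact Subtype.ext (key' _ _ _ (by simp [hs _])))
    fun z z' => by
      ext g
      change (c (s' (z * z')) (s g) : L) = ((c (s' z) (s g) * c (s' z') (s g) :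
        Subgroup.center L) : L)
      rw [← MonoidHom.mul_apply, ← map_mul]
      exact key _ _ _ (by simp [s', hs _])
  refine ⟨θ, fun z l l' hl => ?_⟩
  change ⁅s z, s (π l')⁆ = ⁅l, l'⁆
  rw [key _ l _ (by rw [hs, hl]), key' _ _ l' (by rw [hs])]

/-! ### Amalgams and their maps to twisted products -/

/-- `P` is the amalgamated coproduct of `G` and `K` along `a` and `b` in the variety of groups of
class at most two. -/
structure IsAmalgam {G : Type u} {K : Type v} {P : Type (max u v)} {H : Type*} [Group G] [Group K]
    [Group P] [Group H] (a : H →* G) (b : H →* K) (inl : G →* P) (inr : K →* P) : Prop where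
  commutator_le_center : commutator P ≤ Subgroup.center P
  closure_eq_top : Subgroup.closure (Set.range inl ∪ Set.range inr) = ⊤
  comm : ∀ h, inl (a h) = inr (b h)
  exists_lift : ∀ (Q : Type (max u v)) [Group Q], commutator Q ≤ Subgroup.center Q →
    ∀ (f : G →* Q) (g : K →* Q), (∀ h, f (a h) = g (b h)) →
      ∃ F : P →* Q, (∀ x, F (inl x) = f x) ∧ ∀ y, F (inr y) = g y

namespace IsAmalgam

/-- Exchanges the factors, so that only capability of the first one has to be treated. -/
theorem symm {G : Type u} {K : Type v} {P : Type (max u v)} {H : Type*} [Group G] [Group K]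
    [Group P] [Group H] {a : H →* G} {b : H →* K} {inl : G →* P} {inr : K →* P}
    (hP : IsAmalgam a b inl inr) : IsAmalgam b a inr inl where
  commutator_le_center := hP.commutator_le_center
  closure_eq_top := by rw [Set.union_comm, hP.closure_eq_top]
  comm h := (hP.comm h).symm
  exists_lift Q _ hQ f g hfg := by
    obtain ⟨F, h1, h2⟩ := hP.exists_lift Q hQ g f fun h => (hfg h).symm
    exact ⟨F, h2, h1⟩

variable {G : Type u} {K : Type v} {P : Type (max u v)} {S : Type (max u v)} {H : Type*} [Group G]
  [Group K] [Group P] [Group H] [CommGroup S] {a : H →* G} {b : H →* K} {inl : G →* P}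
  {inr : K →* P}

/-- Left multiplication by a generator preserves the form: moving `inr x` past `inl g` costs `⁅inr
x, inl g⁆ = τ (σ g x)`, which is central. -/
theorem exists_eq_mul (hP : IsAmalgam a b inl inr) {σ : G →* K →* S}
    {τ : S →* Subgroup.center P} (hτ : ∀ g k, (τ (σ g k) : P) = ⁅inr k, inl g⁆) (z : P) :
    ∃ g k s, z = inl g * inr k * τ s := by
  have hz : z ∈ Subgroup.closure (Set.range inl ∪ Set.range inr) := by
    rw [hP.closure_eq_top]; trivial
  have hl : ∀ x y, (∃ g k s, y = inl g * inr k * τ s) →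
      ∃ g k s, inl x * y = inl g * inr k * τ s := by
    rintro x _ ⟨g, k, s, rfl⟩
    exact ⟨x * g, k, s, by simp only [map_mul, mul_assoc]⟩
  have hr : ∀ x y, (∃ g k s, y = inl g * inr k * τ s) →
      ∃ g k s, inr x * y = inl g * inr k * τ s := by
    rintro x _ ⟨g, k, s, rfl⟩
    refine ⟨g, x * k, σ g x * s, ?_⟩
    rw [← mul_assoc, ← mul_assoc, mul_eq_commutatorElement_mul (inr x), ← hτ,
      ← Subgroup.mem_center_iff.1 (τ (σ g x)).2, map_mul, map_mul, Subgroup.coe_mul]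
    have h := Subgroup.mem_center_iff.1 (τ (σ g x)).2
    simp only [mul_assoc]
    rw [← mul_assoc _ (inr k), ← h]
    simp only [mul_assoc]
  refine Subgroup.closure_induction_left (p := fun y _ => ∃ g k s, y = inl g * inr k * τ s)
    ⟨1, 1, 1, by simp⟩ ?_ ?_ hz
  · rintro _ (⟨x, rfl⟩ | ⟨x, rfl⟩) y _ hy
    · exact hl x y hy
    · exact hr x y hy
  · rintro _ (⟨x, rfl⟩ | ⟨x, rfl⟩) y _ hy
    · rw [← map_inv]; exact hl _ y hy
    · rw [← map_inv]; exact hr _ y hy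

/-- The homomorphism from an amalgam to the central quotient of a twisted product. -/
theorem exists_hom_product {L : Type u} [Group L] (hP : IsAmalgam a b inl inr)
    (hG : commutator G ≤ Subgroup.center G) (hK : commutator K ≤ Subgroup.center K)
    (ha : ∀ h, a h ∈ commutator G) (hb : ∀ h, b h ∈ commutator K)
    {σ : G →* K →* S} (hS : Subgroup.closure {s | ∃ g k, s = σ g k} = ⊤)
    (hσl : ∀ g, (∀ k, σ g k = 1) → g ∈ commutator G)
    (hσr : ∀ k, (∀ g, σ g k = 1) → k ∈ commutator K)
    {τ : S →* Subgroup.center P} (hτ : ∀ g k, (τ (σ g k) : P) = ⁅inr k, inl g⁆)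
    {π : L →* G} (hs : Function.Surjective π) (hker : ∀ l, π l = 1 ↔ l ∈ Subgroup.center L)
    {θ : Subgroup.center G →* G →* Subgroup.center L}
    (hθ : ∀ (z : Subgroup.center G) (l l' : L), π l = z → (θ z (π l') : L) = ⁅l, l'⁆)
    (T : QuadraticTwist σ (Subgroup.center L))
    (hT : ∀ h, T.toFun (b h) = θ ⟨a h, hG (ha h)⟩) :
    ∃ F : P →* T.Product π (fun z => (hker z).2) ⧸
        Subgroup.center (T.Product π (fun z => (hker z).2)),
      Function.Surjective F ∧ ∀ g k s, F (inl g * inr k * τ s) = 1 →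
        k ∈ commutator K ∧ T.polar s = 1 ∧ ∃ hg : g ∈ commutator G,
          T.toFun k * θ ⟨g, hG hg⟩ = 1 := by
  have hπ : ∀ z ∈ Subgroup.center L, π z = 1 := fun z => (hker z).2
  let j : L →* T.Product π hπ ⧸ Subgroup.center (T.Product π hπ) := (QuotientGroup.mk' _).comp
    ((SemidirectProduct.inl : L × S →* T.Product π hπ).comp (MonoidHom.inl L S))
  have hj : π.ker ≤ j.ker := fun l hl =>
    (QuotientGroup.eq_one_iff _).2 (QuadraticTwist.inl_mem_center ((hker l).1 hl))
  let f₁ : G →* T.Product π hπ ⧸ Subgroup.center (T.Product π hπ) := π.liftOfSurjective hs ⟨j, hj⟩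
  have hf₁ : ∀ l, f₁ (π l) = j l := fun l =>
    MonoidHom.liftOfRightInverse_comp_apply π _ (Function.rightInverse_surjInv hs) ⟨j, hj⟩ l
  let f₂ : K →* T.Product π hπ ⧸ Subgroup.center (T.Product π hπ) := (QuotientGroup.mk' _).comp
    (SemidirectProduct.inr : K →* T.Product π hπ)
  have hf : ∀ h, f₁ (a h) = f₂ (b h) := by
    intro h
    obtain ⟨l, hl⟩ := hs (a h)
    rw [← hl, hf₁]
    refine QuotientGroup.eq.2 ?_
    have he : (SemidirectProduct.inl ((l, 1) : L × S) : T.Product π hπ)⁻¹ *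
        SemidirectProduct.inr (b h) = ⟨(l⁻¹, 1), b h⟩ := by
      ext <;> simp
    change (SemidirectProduct.inl ((l, 1) : L × S) : T.Product π hπ)⁻¹ *
        SemidirectProduct.inr (b h) ∈ _
    -- By `hT`, `b h` acts on `L` as `l' ↦ l' * ⁅l, l'⁆`, that is, as conjugation by `l`, and it
    -- acts trivially on `S`; hence `l⁻¹ * b h` is central.
    rw [he, QuadraticTwist.mem_center_iff]
    intro l' s k
    have h1 : T.toFun k (a h) = 1 := Abelianization.commutator_subset_ker _ (ha h)
    have h2 : T.polar s (b h) = 1 := Abelianization.commutator_subset_ker _ (hb h)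
    have h3 : σ (a h) = 1 := Abelianization.commutator_subset_ker _ (ha h)
    have h4 : ∀ g, σ g (b h) = 1 := fun g => Abelianization.commutator_subset_ker _ (hb h)
    have h5 : (T.toFun (b h) (π l') : L) = ⁅l, l'⁆ := by rw [hT]; exact hθ _ _ _ hl
    have h6 := Subgroup.mem_center_iff.1 (T.toFun (b h) (π l')).2
    have h7 := Subgroup.mem_center_iff.1 (hK (hb h)) k
    refine ⟨?_, ?_, ?_⟩
    · change l' * l⁻¹ * (T.toFun k (π l⁻¹) * T.polar 1 k : Subgroup.center L) =
        l⁻¹ * l' * (T.toFun (b h) (π l') * T.polar s (b h) : Subgroup.center L)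
      have e1 : T.toFun k (π l⁻¹) * T.polar 1 k = 1 := by simp [hl, h1]
      rw [h2, e1, mul_one (T.toFun (b h) (π l')), mul_assoc l⁻¹, h6, h5, commutatorElement_def]
      simp [mul_assoc]
    · change σ (π l⁻¹) k = σ (π l') (b h)
      simp [hl, h3, h4]
    · exact h7
  obtain ⟨F, hF₁, hF₂⟩ := hP.exists_lift (T.Product π hπ ⧸ Subgroup.center (T.Product π hπ))
    (QuadraticTwist.commutator_le_center_quotient hG hK fun l => (hker l).1) f₁ f₂ hf
  have hFτ : ∀ s, F (τ s) = QuotientGroup.mk' (Subgroup.center (T.Product π hπ))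
      (SemidirectProduct.inl ((1 : L), s)) := by
    have : F.comp ((Subgroup.center P).subtype.comp τ) =
        (QuotientGroup.mk' (Subgroup.center (T.Product π hπ))).comp
          ((SemidirectProduct.inl : L × S →* T.Product π hπ).comp (MonoidHom.inr L S)) := by
      refine MonoidHom.eq_of_eqOn_dense hS ?_
      rintro _ ⟨g, k, rfl⟩
      obtain ⟨l, rfl⟩ := hs g
      change F (τ (σ (π l) k)) = QuotientGroup.mk' (Subgroup.center (T.Product π hπ))
        (SemidirectProduct.inl ((1 : L), σ (π l) k))
      rw [hτ, map_commutatorElement, hF₁, hF₂, hf₁]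
      change QuotientGroup.mk' (Subgroup.center (T.Product π hπ)) ⁅(SemidirectProduct.inr k : T.Product π hπ),
        (SemidirectProduct.inl ((l, 1) : L × S) : T.Product π hπ)⁆ = _
      -- The commutator of `k` with `l` records how `k` moves `l`; its `L`-part `T.toFun k (π l)` is
      -- central and vanishes in the quotient.
      have h8 : ⁅(SemidirectProduct.inr k : T.Product π hπ), (SemidirectProduct.inl ((l, 1) : L × S) : T.Product π hπ)⁆ =
          SemidirectProduct.inl (((T.toFun k (π l) : Subgroup.center L) : L), (1 : S)) *
            SemidirectProduct.inl ((1 : L), σ (π l) k) := by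
        rw [commutatorElement_def, ← map_inv (SemidirectProduct.inr : K →* T.Product π hπ),
          ← SemidirectProduct.inl_aut, ← map_inv (SemidirectProduct.inl : L × S →* T.Product π hπ), ← map_mul, ← map_mul, QuadraticTwist.action_apply]
        refine congrArg _ (Prod.ext ?_ ?_)
        · have h := Subgroup.mem_center_iff.1 (T.toFun k (π l)).2 l
          simp [h]
        · simp
      have h9 : QuotientGroup.mk' (Subgroup.center (T.Product π hπ)) (SemidirectProduct.inl
          (((T.toFun k (π l) : Subgroup.center L) : L), (1 : S))) = 1 :=
        (QuotientGroup.eq_one_iff _).2 (QuadraticTwist.inl_mem_center (SetLike.coe_mem _))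
      rw [h8, map_mul, h9, one_mul]
    exact fun s => DFunLike.congr_fun this s
  refine ⟨F, ?_, ?_⟩
  · intro x
    obtain ⟨⟨⟨l, s⟩, k⟩, rfl⟩ := QuotientGroup.mk_surjective x
    refine ⟨inl (π l) * τ s * inr k, ?_⟩
    rw [map_mul, map_mul, hF₁, hF₂, hFτ, hf₁]
    refine congrArg (QuotientGroup.mk' (Subgroup.center (T.Product π hπ)))
      (SemidirectProduct.ext (Prod.ext ?_ ?_) ?_) <;> simp
  · intro g k s h
    obtain ⟨l, rfl⟩ := hs g
    rw [map_mul, map_mul, hF₁, hF₂, hFτ, hf₁] at h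
    have he : (SemidirectProduct.inl ((l, 1) : L × S) * SemidirectProduct.inr k *
        SemidirectProduct.inl ((1, s) : L × S) : T.Product π hπ) =
          ⟨(l * (T.polar s k : Subgroup.center L), s), k⟩ := by
      ext <;> simp [QuadraticTwist.action_apply]
    have h' : (⟨(l * (T.polar s k : Subgroup.center L), s), k⟩ : T.Product π hπ) ∈
        Subgroup.center (T.Product π hπ) := he ▸ (QuotientGroup.eq_one_iff _).1 h
    rw [QuadraticTwist.mem_center_iff] at h'
    simp only [map_mul π, hπ _ (SetLike.coe_mem _), mul_one] at h'
    -- Centrality is tested against `K` alone (`l = 1`, `s = 1`) and against `L` alone (`s = 1`, `k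
    -- = 1`).
    have hg : π l ∈ commutator G := hσl _ fun x => by simpa using (h' 1 1 x).2.1
    have hk : k ∈ commutator K := hσr _ fun x => by
      obtain ⟨y, rfl⟩ := hs x
      simpa using ((h' y 1 1).2.1).symm
    refine ⟨hk, ?_, hg, ?_⟩
    · ext x
      have h1 : T.toFun x (π l) = 1 := Abelianization.commutator_subset_ker _ hg
      have := (h' 1 1 x).1
      simpa [h1] using this
    · ext x
      obtain ⟨y, rfl⟩ := hs x
      have h1 := (h' y 1 1).1
      have h2 := Subgroup.mem_center_iff.1 (T.polar s k).2
      have h3 := Subgroup.mem_center_iff.1 (T.toFun k (π y)).2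
      simp only [map_one, mul_one, MonoidHom.one_apply, T.map_one, Subgroup.coe_one] at h1
      change (T.toFun k (π y) : L) * (θ ⟨π l, hG hg⟩ (π y) : L) = 1
      have h4 : y * l = l * y * T.toFun k (π y) := by
        rw [← mul_assoc, h2, h2, mul_assoc, mul_assoc] at h1
        simpa only [mul_assoc] using mul_left_cancel h1
      rw [hθ _ l y rfl, commutatorElement_def, ← mul_assoc, ← mul_assoc, ← h3 (l * y), ← h4]
      group

end IsAmalgam

/-! ### The tensor product of the abelianizations -/

/-- The tensor product over `𝔽_p` of two abelianizations, written multiplicatively. -/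
abbrev AbelianizationTensor (p : ℕ) (G : Type u) (K : Type v) [Group G] [Group K]
    [Module (ZMod p) (Additive (Abelianization G))]
    [Module (ZMod p) (Additive (Abelianization K))] : Type (max u v) :=
  Multiplicative (Additive (Abelianization G) ⊗[ZMod p] Additive (Abelianization K))

namespace AbelianizationTensor

variable (p : ℕ) {G : Type u} {K : Type v} [Group G] [Group K]
  [Module (ZMod p) (Additive (Abelianization G))] [Module (ZMod p) (Additive (Abelianization K))]

/-- The class of an element in the additive abelianization. -/
def cls {G : Type*} [Group G] (g : G) : Additive (Abelianization G) :=
  Additive.ofMul (Abelianization.of g)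

theorem cls_mul {G : Type*} [Group G] (g h : G) : cls (g * h) = cls g + cls h := by
  simp [cls]

theorem cls_surjective {G : Type*} [Group G] : Function.Surjective (cls : G → _) := fun x => by
  obtain ⟨g, hg⟩ := QuotientGroup.mk_surjective (Additive.toMul x)
  exact ⟨g, hg⟩

theorem cls_eq_zero {G : Type*} [Group G] {g : G} : cls g = 0 ↔ g ∈ commutator G := by
  rw [← Abelianization.ker_of, MonoidHom.mem_ker]
  rfl

/-- The universal bilinear pairing. -/
def pairing : G →* K →* AbelianizationTensor p G K :=
  MonoidHom.mk' (fun g => MonoidHom.mk' (fun k =>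
    Multiplicative.ofAdd (cls g ⊗ₜ[ZMod p] cls k)) fun k k' => by
      rw [cls_mul, TensorProduct.tmul_add]; rfl) fun g g' => by
    ext k
    change Multiplicative.ofAdd (cls (g * g') ⊗ₜ[ZMod p] cls k) = _
    rw [cls_mul, TensorProduct.add_tmul]; rfl

theorem closure_pairing :
    Subgroup.closure {s | ∃ (g : G) (k : K), s = pairing p g k} = ⊤ := by
  rw [eq_top_iff]
  rintro s -
  have : ∀ t : TensorProduct (ZMod p) (Additive (Abelianization G)) (Additive (Abelianization K)),
      Multiplicative.ofAdd t ∈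
        Subgroup.closure {s | ∃ (g : G) (k : K), s = pairing p g k} := by
    intro t
    induction t using TensorProduct.induction_on with
    | zero => exact one_mem _
    | tmul x y =>
      obtain ⟨g, rfl⟩ := cls_surjective x
      obtain ⟨k, rfl⟩ := cls_surjective y
      exact Subgroup.subset_closure ⟨g, k, rfl⟩
    | add x y hx hy => exact mul_mem hx hy
  exact this (Multiplicative.toAdd s)

theorem exists_lift [NeZero p] {X : Type*} [CommGroup X] (b : G →* K →* X) :
    ∃ F : AbelianizationTensor p G K →* X, ∀ g k, F (pairing p g k) = b g k := by
  let b₁ : Abelianization G →* Abelianization K →* X :=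
    Abelianization.lift (MonoidHom.mk' (fun g => Abelianization.lift (b g)) fun g g' => by
      ext k
      simp)
  let b₂ : Additive (Abelianization G) →+ Additive (Abelianization K) →+ Additive X :=
    AddMonoidHom.mk' (fun x => MonoidHom.toAdditive (b₁ x.toMul)) fun x y => by
      ext z
      simp
  refine ⟨AddMonoidHom.toMultiplicativeLeft (TensorProduct.liftAddHom b₂ ?_), fun g k => ?_⟩
  · intro r x y
    obtain ⟨n, rfl⟩ := ZMod.natCast_zmod_surjective r
    rw [Nat.cast_smul_eq_nsmul, Nat.cast_smul_eq_nsmul, map_nsmul, map_nsmul]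
    rfl
  · change (TensorProduct.liftAddHom b₂ _ (cls g ⊗ₜ[ZMod p] cls k)).toMul = _
    rw [TensorProduct.liftAddHom_tmul]
    simp [b₂, b₁, cls]

variable [Fact p.Prime]

open Module in
-- The coordinates for a tensor product basis are products of coordinates of the factors, so pure
-- tensors of functionals separate points.
theorem exists_dual_ne_zero {s : AbelianizationTensor p G K} (hs : s ≠ 1) :
    ∃ (f : Dual (ZMod p) (Additive (Abelianization G)))
      (f' : Dual (ZMod p) (Additive (Abelianization K))),
      LinearMap.mul' (ZMod p) (ZMod p) (TensorProduct.map f f' s.toAdd) ≠ 0 := by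
  by_contra! h
  refine hs (Multiplicative.toAdd.injective ?_)
  let B := Basis.ofVectorSpace (ZMod p) (Additive (Abelianization G))
  let B' := Basis.ofVectorSpace (ZMod p) (Additive (Abelianization K))
  have key : ∀ i j, (B.tensorProduct B').coord (i, j) =
      (LinearMap.mul' (ZMod p) (ZMod p)).comp (TensorProduct.map (B.coord i) (B'.coord j)) := by
    intro i j
    refine TensorProduct.ext' fun x y => ?_
    simp [mul_comm]
  refine (B.tensorProduct B').ext_elem fun ij => ?_
  have := h (B.coord ij.1) (B'.coord ij.2)
  rw [← LinearMap.comp_apply, ← key, Basis.coord_apply] at this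
  rw [this]
  simp

theorem exists_dual_ne_zero' {g : G} (hg : g ∉ commutator G) :
    ∃ f : Module.Dual (ZMod p) (Additive (Abelianization G)), f (cls g) ≠ 0 := by
  obtain ⟨f, hf, -⟩ := Submodule.exists_le_ker_of_notMem (p := (⊥ : Submodule (ZMod p) _))
    (v := cls g) (by simpa [cls_eq_zero] using hg)
  exact ⟨f, hf⟩

/-- Over a field, nonzero vectors have nonzero tensor product. Given a noncommutator element in each
factor, this identifies both kernels of the pairing with the commutator subgroups. -/
theorem pairing_ne_one {g : G} {k : K} (hg : g ∉ commutator G) (hk : k ∉ commutator K) :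
    pairing p g k ≠ 1 := by
  obtain ⟨f, hf⟩ := exists_dual_ne_zero' p hg
  obtain ⟨f', hf'⟩ := exists_dual_ne_zero' p hk
  intro h
  have h1 : cls g ⊗ₜ[ZMod p] cls k = 0 := h
  have h2 := congrArg (fun t => LinearMap.mul' (ZMod p) (ZMod p) (TensorProduct.map f f' t)) h1
  simp [hf, hf'] at h2

end AbelianizationTensor

open AbelianizationTensor

/-! ### Construction of quadratic twists -/

namespace QuadraticTwist

variable {p : ℕ} [Fact p.Prime] {G : Type u} {K : Type v} [Group G] [Group K]
  [Module (ZMod p) (Additive (Abelianization G))] [Module (ZMod p) (Additive (Abelianization K))]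
  {C : Type*} [CommGroup C]

/-- A linear map on the Baer group of `K` defines a quadratic twist. -/
theorem exists_of_baer {d : ℕ} (hK : commutator K ≤ Subgroup.center K) {B : Type*}
    [AddCommGroup B] {e : K → B} (he : ∀ x y, e (x * y * ⁅x, y⁆ ^ d) = e x + e y)
    (l : B →+ Additive (G →* C)) :
    ∃ T : QuadraticTwist (pairing p : G →* K →* _) C, ∀ k, T.toFun k = (l (e k)).toMul := by
  have hc : ∀ x y : K, ⁅x, y⁆ ∈ Subgroup.center K := fun x y =>
    hK (Subgroup.commutator_mem_commutator trivial trivial)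
  have hz : ∀ x : K, ∀ z ∈ Subgroup.center K, e (x * z) = e x + e z := fun x z h => by
    have := he x z
    rwa [commutatorElement_eq_one_iff_mul_comm.2 (Subgroup.mem_center_iff.1 h x), one_pow,
      mul_one] at this
  let ψ : Subgroup.center K →* (G →* C) :=
    MonoidHom.mk' (fun z => (l (e z)).toMul) fun z z' => by
      rw [Subgroup.coe_mul, hz _ _ z'.2, map_add, toMul_add]
  let c : K →* K →* Subgroup.center K :=
    commutatorPairing (MonoidHom.id K) (MonoidHom.id K) hc
  -- Since `e (x * y) = e x + e y - e (⁅x, y⁆ ^ d)`, the defect of additivity is the inverse of the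
  -- `d`-th power of `ψ`.
  let ψ' : Subgroup.center K →* (G →* C) := (ψ ^ d)⁻¹
  let b : G →* K →* K →* C := MonoidHom.mk' (fun g => MonoidHom.mk' (fun y => MonoidHom.mk'
    (fun x => ψ' (c x y) g)
      fun x x' => by rw [map_mul, MonoidHom.mul_apply, map_mul, MonoidHom.mul_apply])
      fun y y' => by
        ext x
        change ψ' (c x (y * y')) g = ψ' (c x y) g * ψ' (c x y') g
        rw [map_mul, map_mul, MonoidHom.mul_apply]) fun g g' => by
          ext y x
          exact map_mul (ψ' (c x y)) g g'
  obtain ⟨F, hF⟩ := exists_lift p b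
  refine ⟨⟨fun k => (l (e k)).toMul, F, fun x y g => ?_⟩, fun k => rfl⟩
  rw [hF]
  change _ = _ * (ψ (c x y) g ^ d)⁻¹
  rw [eq_mul_inv_iff_mul_eq, ← MonoidHom.pow_apply, ← map_pow, ← MonoidHom.mul_apply,
    ← MonoidHom.mul_apply]
  change ((l (e (x * y))).toMul * (l (e (⁅x, y⁆ ^ d))).toMul) g = _
  rw [← toMul_add, ← toMul_add, ← map_add, ← map_add, ← hz _ _ (pow_mem (hc x y) d), he]

/-- The twist is `c` to the power `f(g) f'(k)²`, whose polarization on `s` is `c` to the power `2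
f'(k) (f ⊗ f')(s)`. It is nontrivial because `p` is odd and `(f ⊗ f')(s) ≠ 0`, which also rules out
`f' = 0`. -/
theorem exists_of_dual {c : C} (hc : c ^ p = 1) (hc1 : c ≠ 1) (hodd : Odd p)
    {s : AbelianizationTensor p G K} (hs : s ≠ 1) :
    ∃ T : QuadraticTwist (pairing p : G →* K →* _) C, (∀ k ∈ commutator K, T.toFun k = 1) ∧
      T.polar s ≠ 1 := by
  obtain ⟨f, f', hff⟩ := exists_dual_ne_zero p hs
  let ε : ZMod p →+ Additive C := ZMod.lift p ⟨zmultiplesHom _ (Additive.ofMul c), by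
    simp [← ofMul_pow, hc]⟩
  have hε1 : ε 1 = Additive.ofMul c := by
    have := ZMod.lift_coe p ⟨zmultiplesHom _ (Additive.ofMul c), by
      simp [← ofMul_pow, hc]⟩ 1
    simpa [ε] using this
  have hε : ∀ r, ε r = 0 → r = 0 := by
    intro r hr
    by_contra h0
    obtain ⟨n, hn⟩ := ZMod.natCast_zmod_surjective r⁻¹
    have h1 : ε 1 = 0 := by
      rw [← inv_mul_cancel₀ h0, ← hn, ← nsmul_eq_mul, map_nsmul, hr, nsmul_zero]
    exact hc1 (hε1 ▸ h1 : Additive.ofMul c = 0)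
  let Φ : Additive (Abelianization G) ⊗[ZMod p] Additive (Abelianization K) →ₗ[ZMod p] ZMod p :=
    (LinearMap.mul' (ZMod p) (ZMod p)).comp (TensorProduct.map f f')
  let T : QuadraticTwist (pairing p : G →* K →* _) C :=
    { toFun := fun k => MonoidHom.mk' (fun g => (ε (f (cls g) * f' (cls k) ^ 2)).toMul)
        fun g g' => by rw [cls_mul, map_add, add_mul, map_add, toMul_add]
      polar := MonoidHom.mk' (fun t => MonoidHom.mk'
        (fun k => (ε (2 * f' (cls k) * Φ t.toAdd)).toMul) fun k k' => by
          rw [cls_mul, map_add, mul_add, add_mul, map_add, toMul_add]) fun t t' => by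
            ext k
            change (ε (2 * f' (cls k) * Φ (t.toAdd + t'.toAdd))).toMul = _
            rw [map_add, mul_add, map_add, toMul_add]
            rfl
      map_mul' := fun x y g => by
        change (ε (f (cls g) * f' (cls (x * y)) ^ 2)).toMul =
          (ε (f (cls g) * f' (cls x) ^ 2)).toMul * (ε (f (cls g) * f' (cls y) ^ 2)).toMul *
            (ε (2 * f' (cls x) * (f (cls g) * f' (cls y)))).toMul
        rw [← toMul_add, ← toMul_add, ← map_add, ← map_add, cls_mul, map_add]
        congr 2
        ring }
  refine ⟨T, fun k hk => ?_, fun h => ?_⟩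
  · ext g
    change (ε (f (cls g) * f' (cls k) ^ 2)).toMul = 1
    rw [cls_eq_zero.2 hk]
    simp
  · have h2 : (2 : ZMod p) ≠ 0 := by
      intro h
      have h3 : p ∣ 2 := (ZMod.natCast_eq_zero_iff 2 p).1 (by exact_mod_cast h)
      have := (Nat.prime_dvd_prime_iff_eq Fact.out Nat.prime_two).1 h3
      subst this
      exact absurd hodd (by decide)
    have h0 : f' = 0 := by
      ext x
      obtain ⟨k, rfl⟩ := cls_surjective x
      have h4 : ε (2 * f' (cls k) * Φ s.toAdd) = 0 := DFunLike.congr_fun h k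
      have h5 : Φ s.toAdd ≠ 0 := hff
      simpa [h2, h5] using hε _ h4
    subst h0
    simp at hff

end QuadraticTwist

/-! ### Linear maps on the Baer space -/

section BaerExtension

variable {p d : ℕ} [Fact p.Prime] {K H B : Type*} [Group K] [CommGroup H] [AddCommGroup B]
  [Module (ZMod p) B] {e : K ≃ B} {b : H →* K}

/-- A subgroup of the centre is a subspace of the Baer group. -/
theorem exists_linearMap_baer [Module (ZMod p) (Additive H)]
    (he : ∀ x y, e (x * y * ⁅x, y⁆ ^ d) = e x + e y) (hb : ∀ h, b h ∈ Subgroup.center K) :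
    ∃ j : Additive H →ₗ[ZMod p] B, ∀ h : H, j (Additive.ofMul h) = e (b h) :=
  ⟨AddMonoidHom.toZModLinearMap p (AddMonoidHom.mk' (fun x => e (b x.toMul)) fun x y => by
    have h := he (b x.toMul) (b y.toMul)
    rwa [commutatorElement_eq_one_iff_mul_comm.2 (Subgroup.mem_center_iff.1 (hb _) _),
      one_pow, mul_one, ← map_mul] at h), fun _ => rfl⟩

/-- The image of `b` is a subspace, so it admits a linear retraction, with which `η` is composed. -/
theorem exists_baer_extension [Module (ZMod p) (Additive H)] {V : Type*} [AddCommGroup V]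
    [Module (ZMod p) V] (he : ∀ x y, e (x * y * ⁅x, y⁆ ^ d) = e x + e y)
    (hb : ∀ h, b h ∈ Subgroup.center K) (hbi : Function.Injective b) (η : Additive H →+ V) :
    ∃ l : B →+ V, ∀ h : H, l (e (b h)) = η (Additive.ofMul h) := by
  obtain ⟨j, hj⟩ := exists_linearMap_baer (p := p) he hb
  have hji : Function.Injective j := fun x y h => hbi (e.injective (((hj _).symm.trans h).trans (hj _)))
  obtain ⟨r, hr⟩ := j.exists_leftInverse_of_injective (LinearMap.ker_eq_bot.2 hji)
  refine ⟨η.comp r.toAddMonoidHom, fun h => ?_⟩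
  rw [← hj]
  exact congrArg η (LinearMap.congr_fun hr _)

/-- A functional vanishing on the subspace `b(H)` but not at `e k`, multiplied by the vector `v`. -/
theorem exists_baer_separation [Module (ZMod p) (Additive H)] {V : Type*} [AddCommGroup V]
    [Module (ZMod p) V] (he : ∀ x y, e (x * y * ⁅x, y⁆ ^ d) = e x + e y)
    (hb : ∀ h, b h ∈ Subgroup.center K) {v : V} (hv : v ≠ 0) {k : K} (hk : ¬ ∃ h, b h = k) :
    ∃ l : B →+ V, (∀ h, l (e (b h)) = 0) ∧ l (e k) ≠ 0 := by
  obtain ⟨j, hj⟩ := exists_linearMap_baer (p := p) he hb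
  have hne : e k ∉ LinearMap.range j := by
    rintro ⟨x, hx⟩
    exact hk ⟨x.toMul, e.injective ((hj _).symm.trans hx)⟩
  obtain ⟨f, hf, hfj⟩ := Submodule.exists_le_ker_of_notMem hne
  refine ⟨(f.smulRight v).toAddMonoidHom, fun h => ?_, smul_ne_zero hf hv⟩
  have h0 : f (e (b h)) = 0 := hfj ⟨Additive.ofMul h, hj h⟩
  change f (e (b h)) • v = 0
  rw [h0, zero_smul]

end BaerExtension

/-! ### Capability of the amalgam -/

theorem AbelianizationTensor.nsmul_eq_zero {p : ℕ} {G : Type*} [Group G] (h : ∀ x : G, x ^ p = 1)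
    (x : Additive (Abelianization G)) : p • x = 0 := by
  obtain ⟨g, rfl⟩ := cls_surjective x
  change Abelianization.of g ^ p = 1
  rw [← map_pow, h, map_one]

/-- An amalgam of groups of class two and odd prime exponent `p`, over a nontrivial group `H`
contained in both commutator subgroups, is capable as soon as the first factor is. -/
theorem IsAmalgam.capable {p : ℕ} [Fact p.Prime] (hodd : Odd p) {G : Type u} {K : Type v}
    {P : Type (max u v)} {H : Type*} [Group G] [Group K] [Group P] [CommGroup H] [Nontrivial H]
    [Module (ZMod p) (Additive (Abelianization G))] [Module (ZMod p) (Additive (Abelianization K))]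
    {a : H →* G} {b : H →* K} {inl : G →* P} {inr : K →* P} (hP : IsAmalgam a b inl inr)
    (hG : commutator G ≤ Subgroup.center G) (hK : commutator K ≤ Subgroup.center K)
    (hGp : ∀ x : G, x ^ p = 1) (hKp : ∀ x : K, x ^ p = 1)
    (ha : ∀ h, a h ∈ commutator G) (hb : ∀ h, b h ∈ commutator K)
    (hai : Function.Injective a) (hbi : Function.Injective b)
    (hGn : ∃ g : G, g ∉ commutator G) (hKn : ∃ k : K, k ∉ commutator K) (hcap : Capable G) :
    Capable P := by
  obtain ⟨L, _, ⟨i⟩⟩ := hcap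
  let π : L →* G := i.symm.toMonoidHom.comp (QuotientGroup.mk' (Subgroup.center L))
  have hs : Function.Surjective π := i.symm.surjective.comp (QuotientGroup.mk'_surjective _)
  have hker : ∀ l, π l = 1 ↔ l ∈ Subgroup.center L := fun l => by
    change i.symm (QuotientGroup.mk' (Subgroup.center L) l) = 1 ↔ _
    rw [map_eq_one_iff i.symm i.symm.injective]
    exact QuotientGroup.eq_one_iff l
  obtain ⟨θ, hθ⟩ := exists_centerPairing π hs hker
  have hθi : ∀ z, θ z = 1 → z = 1 := by
    intro z hz
    obtain ⟨l, hl⟩ := hs z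
    have : l ∈ Subgroup.center L := by
      rw [Subgroup.mem_center_iff]
      intro l'
      have h1 := hθ z l l' hl
      rw [hz] at h1
      exact (commutatorElement_eq_one_iff_mul_comm.1 h1.symm).symm
    exact Subtype.ext (hl ▸ (hker l).2 this)
  let _ : Module (ZMod p) (Additive H) := AddCommGroup.zmodModule (n := p) fun x => by
    refine Additive.toMul.injective (hai ?_)
    rw [toMul_nsmul, map_pow, hGp]
    exact (map_one a).symm
  let _ : Module (ZMod p) (Additive (G →* Subgroup.center L)) :=
    AddCommGroup.zmodModule (n := p) fun f => Additive.toMul.injective <| by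
      ext x : 1
      rw [toMul_nsmul, MonoidHom.pow_apply, ← map_pow, hGp, map_one]
      rfl
  obtain ⟨d, hd⟩ := hodd
  obtain ⟨B, _, _, e, he⟩ := exists_baer_vectorSpace hd hK hKp
  let σ : G →* K →* AbelianizationTensor p G K := pairing p
  obtain ⟨τ, hτ⟩ := AbelianizationTensor.exists_lift p (commutatorPairing inr inl fun k g =>
    hP.commutator_le_center (Subgroup.commutator_mem_commutator trivial trivial)).flip
  have hτ' : ∀ g k, (τ (σ g k) : P) = ⁅inr k, inl g⁆ := fun g k => by rw [hτ]; rfl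
  -- a twist compatible with the commutators in `L`
  obtain ⟨T₀, hT₀⟩ : ∃ T : QuadraticTwist σ (Subgroup.center L),
      ∀ h, T.toFun (b h) = θ ⟨a h, hG (ha h)⟩ := by
    obtain ⟨l, hl⟩ := exists_baer_extension (p := p) he (fun h => hK (hb h)) hbi
      (AddMonoidHom.mk' (fun x : Additive H => Additive.ofMul (θ ⟨a x.toMul, hG (ha _)⟩))
        fun x y => by
          rw [← ofMul_mul, ← map_mul]
          congr 2
          exact Subtype.ext (map_mul a _ _))
    obtain ⟨T, hT⟩ := QuadraticTwist.exists_of_baer (p := p) hK he l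
    exact ⟨T, fun h => by rw [hT, hl]; rfl⟩
  have hmul : ∀ T : QuadraticTwist σ (Subgroup.center L), (∀ h, T.toFun (b h) = 1) →
      ∀ h, (T.mul T₀).toFun (b h) = θ ⟨a h, hG (ha h)⟩ := fun T hT h => by
    change T.toFun (b h) * T₀.toFun (b h) = _
    rw [hT, hT₀, one_mul]
  -- a nontrivial homomorphism to the centre of `L`
  obtain ⟨h₀, hh₀⟩ := exists_ne (1 : H)
  have hv : θ ⟨a h₀, hG (ha h₀)⟩ ≠ 1 := fun h =>
    hh₀ (hai ((congrArg Subtype.val (hθi _ h)).trans (map_one a).symm))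
  obtain ⟨g₀, hg₀⟩ := DFunLike.ne_iff.1 hv
  have key : ∀ T : QuadraticTwist σ (Subgroup.center L), _ → _ := fun T hT =>
    hP.exists_hom_product hG hK ha hb (closure_pairing p)
      (fun g h => by
        by_contra hg
        obtain ⟨k, hk⟩ := hKn
        exact pairing_ne_one p hg hk (h k))
      (fun k h => by
        by_contra hk
        obtain ⟨g, hg⟩ := hGn
        exact pairing_ne_one p hg hk (h g)) hτ' hs hker hθ T hT
  -- The family runs over all compatible twists. Comparing `T.mul T₀` with `T₀` on a common kernel
  -- element isolates the conditions imposed by `T`.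
  let ι := {T : QuadraticTwist σ (Subgroup.center L) //
    ∀ h, T.toFun (b h) = θ ⟨a h, hG (ha h)⟩}
  choose F hF hF' using fun T : ι => key T.1 T.2
  refine Capable.of_jointly_injective (ι := ι) _ F hF fun z hz => ?_
  obtain ⟨g, k, s, rfl⟩ := hP.exists_eq_mul hτ' z
  obtain ⟨hk, hs0, hg, hgk⟩ := hF' ⟨T₀, hT₀⟩ g k s (hz _)
  have hs1 : s = 1 := by
    by_contra hs1
    obtain ⟨T, hT, hTs⟩ := QuadraticTwist.exists_of_dual (C := Subgroup.center L)
      (c := θ ⟨a h₀, hG (ha h₀)⟩ g₀) (by rw [← map_pow, hGp, map_one]) hg₀ ⟨d, hd⟩ hs1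
    obtain ⟨-, h1, -⟩ := hF' ⟨T.mul T₀, hmul T fun h => hT _ (hb h)⟩ g k s (hz _)
    refine hTs ?_
    change T.polar s * T₀.polar s = 1 at h1
    rwa [hs0, mul_one] at h1
  have hkH : ∃ h, b h = k := by
    by_contra hkH
    obtain ⟨l, hl, hlk⟩ := exists_baer_separation (p := p) he (fun h => hK (hb h))
      (v := Additive.ofMul (θ ⟨a h₀, hG (ha h₀)⟩)) hv hkH
    obtain ⟨T, hT⟩ := QuadraticTwist.exists_of_baer (p := p) hK he l
    have hTb : ∀ h, T.toFun (b h) = 1 := fun h => by rw [hT, hl, toMul_zero]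
    obtain ⟨-, -, _, h1⟩ := hF' ⟨T.mul T₀, hmul T hTb⟩ g k s (hz _)
    change T.toFun k * T₀.toFun k * θ ⟨g, hG hg⟩ = 1 at h1
    rw [mul_assoc, hgk, mul_one, hT] at h1
    exact hlk h1
  obtain ⟨h, rfl⟩ := hkH
  -- With `s = 1` and `k = b h`, the remaining condition is `θ (a h * g) = 1`, and `θ` is injective.
  rw [hT₀, ← map_mul] at hgk
  have h1 : a h * g = 1 := congrArg Subtype.val (hθi _ hgk)
  rw [hs1, map_one, Subgroup.coe_one, mul_one, ← hP.comm, ← map_mul,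
    Subgroup.mem_center_iff.1 (hG (ha h)), h1, map_one]

/-! ### The concrete coproduct and the conclusion -/

theorem ClassAtMostTwo.commutator_le_center {G : Type u} [Group G] (h : ClassAtMostTwo G) :
    commutator G ≤ Subgroup.center G :=
  Subgroup.commutator_top_right_eq_bot_iff_le_center.1 h

theorem exists_notMem_commutator {G : Type*} [Group G] (h : commutator G ≤ Subgroup.center G)
    (hna : ∃ x y : G, x * y ≠ y * x) : ∃ g : G, g ∉ commutator G := by
  by_contra! hall
  obtain ⟨x, y, hxy⟩ := hna
  exact hxy (Subgroup.mem_center_iff.1 (h (hall y)) x)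

theorem AmalgamatedCoproduct.isAmalgam {G : Type u} {K : Type v} [Group G] [Group K]
    (H : Subgroup G) (φ : H →* commutator K) :
    IsAmalgam (P := AmalgamatedCoproduct H φ) H.subtype ((commutator K).subtype.comp φ)
      ((QuotientGroup.mk' _).comp (TwoNilpotentProduct.inl G K))
      ((QuotientGroup.mk' _).comp (TwoNilpotentProduct.inr G K)) where
  commutator_le_center := by
    have hs := QuotientGroup.mk'_surjective (Subgroup.normalClosure (amalgamSet H φ))
    rw [← Subgroup.commutator_top_right_eq_bot_iff_le_center, commutator_def,
      ← Subgroup.map_top_of_surjective _ hs, ← Subgroup.map_commutator,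
      ← Subgroup.map_commutator, ← commutator_def,
      Subgroup.commutator_top_right_eq_bot_iff_le_center.2
        (TwoNilpotentProduct.commutator_le_center G K), Subgroup.map_bot]
  closure_eq_top := by
    let q : Monoid.Coprod G K →* AmalgamatedCoproduct H φ :=
      (QuotientGroup.mk' (Subgroup.normalClosure (amalgamSet H φ))).comp (QuotientGroup.mk' _)
    have hq : Function.Surjective q :=
      (QuotientGroup.mk'_surjective _).comp (QuotientGroup.mk'_surjective _)
    have h := q.map_closure (Set.range Monoid.Coprod.inl ∪ Set.range Monoid.Coprod.inr)
    rw [Monoid.Coprod.closure_range_inl_union_inr, Subgroup.map_top_of_surjective q hq,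
      Set.image_union, ← Set.range_comp, ← Set.range_comp] at h
    exact h.symm
  comm h := by
    refine QuotientGroup.eq_iff_div_mem.2 (Subgroup.subset_normalClosure ⟨h, ?_⟩)
    rw [div_eq_mul_inv]
    rfl
  exists_lift Q _ hQ f g hfg := by
    let F₁ : TwoNilpotentProduct G K →* Q :=
      QuotientGroup.lift _ (Monoid.Coprod.lift f g) <| by
        have h : (⊤ : Subgroup Q).lowerCentralSeries 2 = ⊥ :=
          Subgroup.commutator_top_right_eq_bot_iff_le_center.2 hQ
        intro x hx
        have h1 := Subgroup.mem_map_of_mem (Monoid.Coprod.lift f g) hx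
        rw [Subgroup.map_lowerCentralSeries] at h1
        have h2 := Subgroup.lowerCentralSeries_mono 2 (le_top :
          (⊤ : Subgroup _).map (Monoid.Coprod.lift f g) ≤ ⊤) h1
        exact (h.le h2 : _)
    have hl : ∀ x, F₁ (TwoNilpotentProduct.inl G K x) = f x := fun x =>
      Monoid.Coprod.lift_apply_inl f g x
    have hr : ∀ y, F₁ (TwoNilpotentProduct.inr G K y) = g y := fun y =>
      Monoid.Coprod.lift_apply_inr f g y
    refine ⟨QuotientGroup.lift _ F₁ fun x hx => ?_, hl, hr⟩
    refine Subgroup.normalClosure_le_normal (N := F₁.ker) ?_ hx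
    rintro _ ⟨h, rfl⟩
    change F₁ _ = 1
    rw [map_mul, map_inv, hl, hr, mul_inv_eq_one]
    exact hfg h

theorem mainTheorem12 (p : ℕ) (hp : p.Prime) (hodd : Odd p)
    (G : Type u) (K : Type v) [Group G] [Group K]
    (hG : ClassAtMostTwo G) (hK : ClassAtMostTwo K)
    (hGp : Monoid.exponent G = p) (hKp : Monoid.exponent K = p)
    (hGna : ∃ x y : G, x * y ≠ y * x) (hKna : ∃ x y : K, x * y ≠ y * x)
    (H : Subgroup G) (hH : H ≤ commutator G) (hHnt : H ≠ ⊥)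
    (φ : H →* commutator K) (hφ : Function.Injective φ)
    (hcap : Capable G ∨ Capable K) :
    Capable (AmalgamatedCoproduct H φ) := by
  have : Fact p.Prime := ⟨hp⟩
  have hG' := hG.commutator_le_center
  have hK' := hK.commutator_le_center
  have hGp' : ∀ x : G, x ^ p = 1 := fun x => hGp ▸ Monoid.pow_exponent_eq_one x
  have hKp' : ∀ x : K, x ^ p = 1 := fun x => hKp ▸ Monoid.pow_exponent_eq_one x
  have hGn := exists_notMem_commutator hG' hGna
  have hKn := exists_notMem_commutator hK' hKna
  let _ : CommGroup H :=
    { (inferInstance : Group H) with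
      mul_comm := fun x y => Subtype.ext (Subgroup.mem_center_iff.1 (hG' (hH y.2)) x) }
  let _ : Module (ZMod p) (Additive (Abelianization G)) :=
    AddCommGroup.zmodModule (nsmul_eq_zero hGp')
  let _ : Module (ZMod p) (Additive (Abelianization K)) :=
    AddCommGroup.zmodModule (nsmul_eq_zero hKp')
  have : Nontrivial H := H.nontrivial_iff_ne_bot.2 hHnt
  have hP := AmalgamatedCoproduct.isAmalgam H φ
  have hbi : Function.Injective ((commutator K).subtype.comp φ) :=
    (Subgroup.subtype_injective _).comp hφ
  rcases hcap with hcap | hcap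
  · exact hP.capable hodd hG' hK' hGp' hKp' (fun h => hH h.2) (fun h => (φ h).2)
      (Subgroup.subtype_injective _) hbi hGn hKn hcap
  · exact hP.symm.capable hodd hK' hG' hKp' hGp' (fun h => (φ h).2) (fun h => hH h.2)
      hbi (Subgroup.subtype_injective _) hKn hGn hcap
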